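/- Let $k$ be an algebraically closed field of characteristic zero and let $n,d\ge 0$ be integers. Put $G=\mathrm{GL}_n$ over $k$, $\mathfrak g=\mathfrak{gl}_n$, let $\mathfrak t\subset\mathfrak g$ be the Cartan subalgebra of diagonal matrices and $W=\mathfrak S_n$ the Weyl group, acting diagonally on $\mathfrak t^d$ by permuting diagonal entries. Let $\mathfrak C^d_G\subset\mathfrak g^d$ be the commuting scheme, i.e. the scheme-theoretic zero fibre of the commutator map $(\theta_1,\dots,\theta_d)\mapsto([\theta_i,\theta_j])_{i<j}$, with the action of $G$ by simultaneous conjugation, and let $$\mathfrak C^d_G/\!\!/G=\operatorname{Spec}\,k[\mathfrak C^d_G]^G,\qquad \mathfrak t^d/\!\!/W=\operatorname{Spec}\,k[\mathfrak t^d]^W$$ be the categorical quotients. The embedding $\mathfrak t^d\hookrightarrow\mathfrak C^d_G$ induces, by restriction of invariant functions, a morphism $\mathfrak t^d/\!\!/W\to\mathfrak C^d_G/\!\!/G$. Put $\operatorname{Chow}_n(\mathbb A^d)=\operatorname{Spec}\big((k[v_1,\dots,v_d]^{\otimes n})^{\mathfrak S_n}\big)$, and identify it with $\mathfrak t^d/\!\!/W$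 by sending $f_1\otimes\cdots\otimes f_n$ to the function $\prod_{j=1}^n f_j(t_{1j},\dots,t_{dj})$ on $\mathfrak t^d$, where $t_{ij}$ is the $j$-th diagonal entry of the $i$-th matrix. **Theorem.** There is a $G$-invariant morphism of $k$-schemes $$\mathrm{sd}:\mathfrak C^d_G\longrightarrow\mathfrak t^d/\!\!/W=\operatorname{Chow}_n(\mathbb A^d)$$ with the following properties. 1. The composition $\mathfrak t^d\to\mathfrak C^d_G\xrightarrow{\mathrm{sd}}\mathfrak t^d/\!\!/W$ is the quotient morphism, and the composition $\mathfrak C^d_G\xrightarrow{\mathrm{sd}}\mathfrak t^d/\!\!/W\to\mathfrak C^d_G/\!\!/G$ is the quotient morphism. 2. For every commutative $k$-algebra $R$ and all pairwise commuting matrices $\alpha_1,\dots,\alpha_d\in\mathfrak{gl}_n(R)$, let $\operatorname{Sym}(\alpha):k[v_1,\dots,v_d]\to\mathfrak{gl}_n(R)$ be the $k$-algebra homomorphism with $v_i\mapsto\alpha_i$. Then there is exactly one $k$-linear map $z(\alpha):(k[v_1,\dots,v_d]^{\otimes n})^{\mathfrak S_n}\to R$ such that $$z(\alpha)(f^{\otimes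 n})=\det\big(\operatorname{Sym}(\alpha)(f)\big)\qquad\text{for all } f\in k[v_1,\dots,v_d];$$ it is a homomorphism of $k$-algebras, and the corresponding $R$-point of $\operatorname{Chow}_n(\mathbb A^d)$ is the image under $\mathrm{sd}$ of the $R$-point $(\alpha_1,\dots,\alpha_d)$ of $\mathfrak C^d_G$. Moreover, the categorical quotient $\mathfrak C^d_G/\!\!/G$ is reduced. -/

import Mathlib

open CategoryTheory AlgebraicGeometry
open scoped TensorProduct

universe u

noncomputable section

namespace CommutingScheme

/-! ### Affine schemes over a field -/

section Spec

variable (k : Type u) [Field k]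

/-- `Spec A` as a scheme over `Spec k`, for a commutative `k`-algebra `A`. -/
def specOver (A : Type u) [CommRing A] [Algebra k A] : Over (Spec (CommRingCat.of k)) :=
  Over.mk (Spec.map (CommRingCat.ofHom (algebraMap k A)))

variable {k}

/-- The morphism of `k`-schemes `Spec B ⟶ Spec A` attached to a `k`-algebra homomorphism
`A → B`. -/
def specMap {A B : Type u} [CommRing A] [Algebra k A] [CommRing B] [Algebra k B]
    (φ : A →ₐ[k] B) : specOver k B ⟶ specOver k A :=
  Over.homMk (Spec.map (CommRingCat.ofHom φ.toRingHom)) (by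
    dsimp only [specOver, Over.mk_left, Over.mk_hom]
    rw [← Spec.map_comp, ← CommRingCat.ofHom_comp]
    congr 2
    exact φ.comp_algebraMap)

end Spec

variable (k : Type u) [Field k] (n d : ℕ)

/-! ### The scheme of commuting `d`-tuples of `n × n` matrices -/

/-- The coordinate ring `k[𝔤^d]`, where `𝔤 = 𝔤𝔩_n`: the variable `X (l, a, b)` is the
`(a, b)`-entry of the `l`-th matrix. -/
abbrev TupleRing : Type u := MvPolynomial (Fin d × Fin n × Fin n) k

/-- The `l`-th universal matrix over `k[𝔤^d]`. -/
def tupleMatrix (l : Fin d) : Matrix (Fin n) (Fin n) (TupleRing k n d) :=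
  Matrix.of fun a b => MvPolynomial.X (l, a, b)

/-- The ideal generated by all entries of all commutators of the universal matrices; it cuts out
the scheme-theoretic zero fibre of the commutator map. -/
def commutatorIdeal : Ideal (TupleRing k n d) :=
  Ideal.span {f | ∃ (i j : Fin d) (a b : Fin n),
    f = (tupleMatrix k n d i * tupleMatrix k n d j
      - tupleMatrix k n d j * tupleMatrix k n d i) a b}

/-- The coordinate ring `k[ℭ]` of the commuting scheme. -/
def CoordRing : Type u := TupleRing k n d ⧸ commutatorIdeal k n d

instance : CommRing (CoordRing k n d) :=
  inferInstanceAs (CommRing (TupleRing k n d ⧸ commutatorIdeal k n d))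

instance : Algebra k (CoordRing k n d) :=
  inferInstanceAs (Algebra k (TupleRing k n d ⧸ commutatorIdeal k n d))

/-- The quotient homomorphism `k[𝔤^d] → k[ℭ]`. -/
def toCoordRing : TupleRing k n d →ₐ[k] CoordRing k n d :=
  Ideal.Quotient.mkₐ k (commutatorIdeal k n d)

/-- The `l`-th universal matrix over `k[ℭ]`. -/
def univMatrix (l : Fin d) : Matrix (Fin n) (Fin n) (CoordRing k n d) :=
  (tupleMatrix k n d l).map (toCoordRing k n d)

theorem univMatrix_comm (i j : Fin d) :
    univMatrix k n d i * univMatrix k n d j = univMatrix k n d j * univMatrix k n d i := by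
  unfold univMatrix
  rw [← Matrix.map_mul, ← Matrix.map_mul]
  ext a b
  simp only [Matrix.map_apply]
  refine (Ideal.Quotient.mk_eq_mk_iff_sub_mem _ _).mpr (Ideal.subset_span ⟨i, j, a, b, ?_⟩)
  rfl

variable {k n d}

/-- The `R`-point of the commuting scheme, i.e. the homomorphism `k[ℭ] → R`, defined by a
`d`-tuple of commuting `n × n` matrices over a `k`-algebra `R`. -/
def point {R : Type u} [CommRing R] [Algebra k R] (α : Fin d → Matrix (Fin n) (Fin n) R)
    (hα : ∀ i j, α i * α j = α j * α i) : CoordRing k n d →ₐ[k] R :=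
  Ideal.Quotient.liftₐ (commutatorIdeal k n d)
    (MvPolynomial.aeval fun p : Fin d × Fin n × Fin n => α p.1 p.2.1 p.2.2) (by
      have key : ∀ l, (tupleMatrix k n d l).map
          (MvPolynomial.aeval fun p : Fin d × Fin n × Fin n => α p.1 p.2.1 p.2.2) = α l := by
        intro l
        ext a b
        simp [tupleMatrix]
      intro f hf
      refine Submodule.span_induction (p := fun f _ => MvPolynomial.aeval
        (fun p : Fin d × Fin n × Fin n => α p.1 p.2.1 p.2.2) f = 0) ?_ (map_zero _)
        (fun x y _ _ hx hy => by rw [map_add, hx, hy, add_zero])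
        (fun a x _ hx => by rw [smul_eq_mul, map_mul, hx, mul_zero]) hf
      rintro f ⟨i, j, a, b, rfl⟩
      have h := congrFun (congrFun (hα i j) a) b
      rw [← key i, ← key j, ← Matrix.map_mul, ← Matrix.map_mul] at h
      rw [Matrix.sub_apply, map_sub, sub_eq_zero]
      simpa only [Matrix.map_apply] using h)

theorem point_univMatrix {R : Type u} [CommRing R] [Algebra k R]
    (α : Fin d → Matrix (Fin n) (Fin n) R) (hα : ∀ i j, α i * α j = α j * α i) (l : Fin d) :
    (univMatrix k n d l).map (point (k := k) α hα) = α l := by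
  ext a b
  have h : point (k := k) α hα (toCoordRing k n d (MvPolynomial.X (l, a, b))) =
      MvPolynomial.aeval (fun p : Fin d × Fin n × Fin n => α p.1 p.2.1 p.2.2)
        (MvPolynomial.X (l, a, b) : TupleRing k n d) := rfl
  rw [MvPolynomial.aeval_X] at h
  exact h

theorem hom_ext {R : Type u} [CommRing R] [Algebra k R] {φ ψ : CoordRing k n d →ₐ[k] R}
    (h : ∀ l, (univMatrix k n d l).map φ = (univMatrix k n d l).map ψ) : φ = ψ := by
  have h1 : φ.comp (toCoordRing k n d) = ψ.comp (toCoordRing k n d) := by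
    apply MvPolynomial.algHom_ext
    rintro ⟨l, a, b⟩
    exact congrFun (congrFun (h l) a) b
  ext x
  obtain ⟨y, rfl⟩ : ∃ y, toCoordRing k n d y = x := Ideal.Quotient.mk_surjective x
  exact DFunLike.congr_fun h1 y

variable (k n d)

/-- The commuting scheme `ℭ ⊆ 𝔤^d`, as a `k`-scheme. -/
abbrev scheme : Over (Spec (CommRingCat.of k)) := specOver k (CoordRing k n d)

/-! ### The general linear group and its action -/

/-- The coordinate ring `k[x_{ab}][1/det]` of `GL_n`. -/
abbrev GLRing : Type u := Localization.Away (Matrix.mvPolynomialX (Fin n) (Fin n) k).det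

/-- The universal invertible matrix, over the coordinate ring of `GL_n`. -/
def glMatrix : Matrix (Fin n) (Fin n) (GLRing k n) :=
  (Matrix.mvPolynomialX (Fin n) (Fin n) k).map (algebraMap _ (GLRing k n))

theorem isUnit_det_glMatrix : IsUnit (glMatrix k n).det := by
  have h : (glMatrix k n).det =
      algebraMap _ (GLRing k n) (Matrix.mvPolynomialX (Fin n) (Fin n) k).det :=
    (RingHom.map_det _ _).symm
  rw [h]
  exact IsLocalization.Away.algebraMap_isUnit _

variable {k n} in
/-- The `R`-point of `GL_n` defined by an invertible matrix over a `k`-algebra `R`. -/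
def glPoint {R : Type u} [CommRing R] [Algebra k R] (g : Matrix (Fin n) (Fin n) R)
    (hg : IsUnit g.det) : GLRing k n →ₐ[k] R :=
  IsLocalization.liftAlgHom (M := Submonoid.powers (Matrix.mvPolynomialX (Fin n) (Fin n) k).det)
    (f := MvPolynomial.aeval fun p : Fin n × Fin n => g p.1 p.2) (by
      rintro ⟨_, m, rfl⟩
      have h : MvPolynomial.aeval (fun p : Fin n × Fin n => g p.1 p.2)
          (Matrix.mvPolynomialX (Fin n) (Fin n) k).det = g.det := by
        rw [AlgHom.map_det]
        congr 1
        ext a b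
        simp
      simpa [h] using hg.pow m)

variable {k n} in
theorem glPoint_glMatrix {R : Type u} [CommRing R] [Algebra k R] (g : Matrix (Fin n) (Fin n) R)
    (hg : IsUnit g.det) : (glMatrix k n).map (glPoint (k := k) g hg) = g := by
  ext a b
  simp [glMatrix, glPoint]

/-- The ring of functions on `GL_n × ℭ`. -/
abbrev GLTensor : Type u := GLRing k n ⊗[k] CoordRing k n d

/-- The pullback to `GL_n × ℭ` of the universal invertible matrix. -/
def actG : Matrix (Fin n) (Fin n) (GLTensor k n d) :=
  (glMatrix k n).map
    (Algebra.TensorProduct.includeLeft : GLRing k n →ₐ[k] GLTensor k n d)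

/-- The pullback to `GL_n × ℭ` of the universal commuting matrices. -/
def actX (l : Fin d) : Matrix (Fin n) (Fin n) (GLTensor k n d) :=
  (univMatrix k n d l).map
    (Algebra.TensorProduct.includeRight : CoordRing k n d →ₐ[k] GLTensor k n d)

theorem isUnit_det_actG : IsUnit (actG k n d).det := by
  have h : (actG k n d).det =
      (Algebra.TensorProduct.includeLeft : GLRing k n →ₐ[k] GLTensor k n d)
        (glMatrix k n).det := (AlgHom.map_det _ _).symm
  rw [h]
  exact (isUnit_det_glMatrix k n).map _

variable {n d} in
theorem conj_comm {R : Type u} [CommRing R] {g : Matrix (Fin n) (Fin n) R} (hg : IsUnit g.det)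
    {α : Fin d → Matrix (Fin n) (Fin n) R} (hα : ∀ i j, α i * α j = α j * α i) (i j : Fin d) :
    (g * α i * g⁻¹) * (g * α j * g⁻¹) = (g * α j * g⁻¹) * (g * α i * g⁻¹) := by
  have h : ∀ i j, (g * α i * g⁻¹) * (g * α j * g⁻¹) = g * (α i * α j) * g⁻¹ := by
    intro i j
    calc (g * α i * g⁻¹) * (g * α j * g⁻¹) = g * α i * (g⁻¹ * g) * α j * g⁻¹ := by
          simp only [Matrix.mul_assoc]
      _ = g * (α i * α j) * g⁻¹ := by
          rw [Matrix.nonsing_inv_mul g hg, Matrix.mul_one, Matrix.mul_assoc g (α i) (α j)]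
  rw [h, h, hα]

theorem actX_comm (i j : Fin d) :
    actX k n d i * actX k n d j = actX k n d j * actX k n d i := by
  unfold actX
  rw [← Matrix.map_mul, ← Matrix.map_mul, univMatrix_comm]

/-- The coaction `k[ℭ] → k[GL_n] ⊗ k[ℭ]` of the diagonal adjoint action
`(g, (x_1, …, x_d)) ↦ (g x_1 g⁻¹, …, g x_d g⁻¹)`. -/
def coaction : CoordRing k n d →ₐ[k] GLTensor k n d :=
  point (fun l => actG k n d * actX k n d l * (actG k n d)⁻¹)
    (conj_comm (isUnit_det_actG k n d) (actX_comm k n d))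

/-- The action morphism `GL_n × ℭ ⟶ ℭ`. -/
def actionMap : specOver k (GLTensor k n d) ⟶ scheme k n d :=
  specMap (coaction k n d)

/-- The second projection `GL_n × ℭ ⟶ ℭ`. -/
def secondProj : specOver k (GLTensor k n d) ⟶ scheme k n d :=
  specMap (Algebra.TensorProduct.includeRight : CoordRing k n d →ₐ[k] GLTensor k n d)

variable {k n d} in
/-- A morphism of `k`-schemes `f : ℭ ⟶ Y` is `GL_n`-invariant if `f(g · x) = f(x)` on
`GL_n × ℭ`. -/
def IsGLInvariant {Y : Over (Spec (CommRingCat.of k))} (f : scheme k n d ⟶ Y) : Prop :=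
  actionMap k n d ≫ f = secondProj k n d ≫ f

/-- The ring `k[ℭ]^{GL_n}` of invariant functions. -/
def invariants : Subalgebra k (CoordRing k n d) :=
  AlgHom.equalizer (coaction k n d) Algebra.TensorProduct.includeRight

/-- The categorical quotient `ℭ // GL_n = Spec k[ℭ]^{GL_n}`. -/
abbrev quotient : Over (Spec (CommRingCat.of k)) := specOver k (invariants k n d)

/-- The quotient morphism `ℭ ⟶ ℭ // GL_n`. -/
def quotientMap : scheme k n d ⟶ quotient k n d := specMap (invariants k n d).val

/-! ### The Cartan subalgebra of diagonal matrices and the Weyl group `𝔖_n` -/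

/-- The coordinate ring `k[𝔱^d]`, where `𝔱` is the space of diagonal `n × n` matrices: the
variable `X (l, j)` is the `j`-th diagonal entry of the `l`-th matrix. -/
abbrev CartanRing : Type u := MvPolynomial (Fin d × Fin n) k

/-- The `l`-th universal diagonal matrix, over `k[𝔱^d]`. -/
def cartanMatrix (l : Fin d) : Matrix (Fin n) (Fin n) (CartanRing k n d) :=
  Matrix.diagonal fun j => MvPolynomial.X (l, j)

theorem cartanMatrix_comm (i j : Fin d) :
    cartanMatrix k n d i * cartanMatrix k n d j = cartanMatrix k n d j * cartanMatrix k n d i := by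
  simp only [cartanMatrix, Matrix.diagonal_mul_diagonal, mul_comm]

/-- Restriction of functions from `ℭ` to `𝔱^d`. -/
def restrict : CoordRing k n d →ₐ[k] CartanRing k n d :=
  point (cartanMatrix k n d) (cartanMatrix_comm k n d)

/-- The scheme `𝔱^d`. -/
abbrev cartan : Over (Spec (CommRingCat.of k)) := specOver k (CartanRing k n d)

/-- The embedding `𝔱^d ⟶ ℭ`. -/
def cartanEmbedding : cartan k n d ⟶ scheme k n d := specMap (restrict k n d)

/-- The diagonal action of a permutation `σ ∈ W = 𝔖_n` on `k[𝔱^d]`, permuting the diagonal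
entries. -/
def weylAct (σ : Equiv.Perm (Fin n)) : CartanRing k n d →ₐ[k] CartanRing k n d :=
  MvPolynomial.rename fun p => (p.1, σ p.2)

/-- The ring `k[𝔱^d]^W`. -/
def weylInvariants : Subalgebra k (CartanRing k n d) :=
  ⨅ σ : Equiv.Perm (Fin n), AlgHom.equalizer (weylAct k n d σ) (AlgHom.id k _)

/-- The quotient `𝔱^d // W`. -/
abbrev cartanQuotient : Over (Spec (CommRingCat.of k)) := specOver k (weylInvariants k n d)

/-- The quotient morphism `𝔱^d ⟶ 𝔱^d // W`. -/
def cartanQuotientMap : cartan k n d ⟶ cartanQuotient k n d :=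
  specMap (weylInvariants k n d).val

variable {k n d} in
theorem mem_weylInvariants {f : CartanRing k n d} :
    f ∈ weylInvariants k n d ↔ ∀ σ, weylAct k n d σ f = f := by
  simp [weylInvariants, Algebra.mem_iInf, AlgHom.mem_equalizer]

/-- The restriction of a `GL_n`-invariant function to `𝔱^d` is `W`-invariant. -/
theorem restrict_mem (f : CoordRing k n d) (hf : f ∈ invariants k n d) :
    restrict k n d f ∈ weylInvariants k n d := by
  rw [mem_weylInvariants]
  intro σ
  -- the permutation matrix of `σ`
  let P : Matrix (Fin n) (Fin n) (CartanRing k n d) := σ.permMatrix _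
  have hP : IsUnit P.det := by
    simp only [P, Matrix.det_permutation]
    exact (Units.isUnit (Equiv.Perm.sign σ)).map (Int.castRingHom (CartanRing k n d))
  let ev : GLTensor k n d →ₐ[k] CartanRing k n d :=
    Algebra.TensorProduct.lift (glPoint P hP) (restrict k n d) (fun _ _ => Commute.all _ _)
  have hG : (actG k n d).map ev = P := by
    have : (actG k n d).map ev = (glMatrix k n).map (glPoint (k := k) P hP) := by
      ext a b
      simp [actG, ev]
    rw [this, glPoint_glMatrix]
  have hX : ∀ l, (actX k n d l).map ev = cartanMatrix k n d l := by
    intro l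
    have : (actX k n d l).map ev = (univMatrix k n d l).map (restrict k n d) := by
      ext a b
      simp [actX, ev]
    rw [this]
    exact point_univMatrix _ _ l
  have h1 : ev.comp (coaction k n d) = (weylAct k n d σ).comp (restrict k n d) := by
    apply hom_ext
    intro l
    have e1 : (univMatrix k n d l).map (ev.comp (coaction k n d)) =
        P * cartanMatrix k n d l * P⁻¹ := by
      have h2 : (univMatrix k n d l).map (coaction k n d) =
          actG k n d * actX k n d l * (actG k n d)⁻¹ := point_univMatrix _ _ l
      have h3 : (univMatrix k n d l).map (ev.comp (coaction k n d)) =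
          ((univMatrix k n d l).map (coaction k n d)).map ev := by
        ext a b
        simp
      have h4 : ((actG k n d)⁻¹).map ev = P⁻¹ := by
        symm
        apply Matrix.inv_eq_right_inv
        rw [← hG, ← Matrix.map_mul, Matrix.mul_nonsing_inv _ (isUnit_det_actG k n d),
          Matrix.map_one _ (map_zero ev) (map_one ev)]
      rw [h3, h2, Matrix.map_mul, Matrix.map_mul, hG, hX, h4]
    have e2 : (univMatrix k n d l).map ((weylAct k n d σ).comp (restrict k n d)) =
        (cartanMatrix k n d l).map (weylAct k n d σ) := by
      have h3 : (univMatrix k n d l).map ((weylAct k n d σ).comp (restrict k n d)) =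
          ((univMatrix k n d l).map (restrict k n d)).map (weylAct k n d σ) := by
        ext a b
        simp
      rw [h3]
      congr 1
      exact point_univMatrix _ _ l
    rw [e1, e2]
    have e3 : P * cartanMatrix k n d l = (cartanMatrix k n d l).map (weylAct k n d σ) * P := by
      refine Matrix.ext fun a b => ?_
      by_cases hab : σ a = b
      · subst hab
        simp [P, cartanMatrix, weylAct, Matrix.mul_apply, Matrix.diagonal_apply,
          Equiv.Perm.permMatrix, PEquiv.toMatrix_apply]
      · have h8 : ∀ j, (cartanMatrix k n d l).map (weylAct k n d σ) a j * P j b = 0 := by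
          intro j
          by_cases haj : a = j
          · subst haj
            simp [P, Equiv.Perm.permMatrix, PEquiv.toMatrix_apply, hab]
          · simp [cartanMatrix, haj]
        rw [Matrix.mul_apply, Matrix.mul_apply, Finset.sum_eq_zero (fun j _ => h8 j)]
        refine Finset.sum_eq_zero fun j _ => ?_
        by_cases hjb : j = b
        · subst hjb
          simp [P, Equiv.Perm.permMatrix, PEquiv.toMatrix_apply, hab]
        · simp [cartanMatrix, hjb]
    rw [e3, Matrix.mul_assoc, Matrix.mul_nonsing_inv _ hP, Matrix.mul_one]
  have h5 : coaction k n d f = Algebra.TensorProduct.includeRight f := hf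
  have h6 := DFunLike.congr_fun h1 f
  simp only [AlgHom.comp_apply, h5] at h6
  rw [← h6]
  simp [ev]

/-- The restriction homomorphism `k[ℭ]^{GL_n} → k[𝔱^d]^W`. -/
def restrictInvariants : invariants k n d →ₐ[k] weylInvariants k n d :=
  ((restrict k n d).comp (invariants k n d).val).codRestrict (weylInvariants k n d)
    fun f => restrict_mem k n d f.1 f.2

/-- The Chevalley restriction morphism `𝔱^d // W ⟶ ℭ // GL_n`. -/
def chevalley : cartanQuotient k n d ⟶ quotient k n d := specMap (restrictInvariants k n d)

/-! ### The Chow scheme of zero-cycles of length `n` on `𝔸^d` -/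

/-- The tensor power `k[v_1, …, v_d]^{⊗ n}`. -/
abbrev TensorPow : Type u := ⨂[k] _ : Fin n, MvPolynomial (Fin d) k

/-- The action of a permutation on `k[v_1, …, v_d]^{⊗ n}`, permuting the factors:
`⨂_j f_j ↦ ⨂_j f_{σ⁻¹ j}`. -/
def tensorAct (σ : Equiv.Perm (Fin n)) : TensorPow k n d →ₐ[k] TensorPow k n d :=
  PiTensorProduct.liftAlgHom
    ((PiTensorProduct.tprod k (s := fun _ : Fin n => MvPolynomial (Fin d) k)).domDomCongr σ.symm)
    rfl (fun x y => (PiTensorProduct.tprod_mul_tprod (R := k) (fun j => x (σ.symm j))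
      (fun j => y (σ.symm j))).symm)

/-- The ring `(k[v_1, …, v_d]^{⊗ n})^{𝔖_n}` of symmetric tensors. -/
def chowRing : Subalgebra k (TensorPow k n d) :=
  ⨅ σ : Equiv.Perm (Fin n), AlgHom.equalizer (tensorAct k n d σ) (AlgHom.id k _)

/-- `Chow_n(𝔸^d) = Spec (k[v_1, …, v_d]^{⊗ n})^{𝔖_n}`. -/
abbrev chow : Over (Spec (CommRingCat.of k)) := specOver k (chowRing k n d)

variable {k n d} in
theorem mem_chowRing {x : TensorPow k n d} :
    x ∈ chowRing k n d ↔ ∀ σ, tensorAct k n d σ x = x := by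
  simp [chowRing, Algebra.mem_iInf, AlgHom.mem_equalizer]

theorem tensorAct_tprod (σ : Equiv.Perm (Fin n)) (f : Fin n → MvPolynomial (Fin d) k) :
    tensorAct k n d σ (PiTensorProduct.tprod k f) =
      PiTensorProduct.tprod k fun j => f (σ.symm j) :=
  PiTensorProduct.lift.tprod _

variable {k d} in
/-- The symmetric tensor `f^{⊗ n} = f ⊗ ⋯ ⊗ f`. -/
def tensorPow (f : MvPolynomial (Fin d) k) : chowRing k n d :=
  ⟨PiTensorProduct.tprod k fun _ => f, mem_chowRing.mpr fun σ => tensorAct_tprod k n d σ _⟩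

/-- The homomorphism `k[v_1, …, v_d]^{⊗ n} → k[𝔱^d]` sending
`⨂_j f_j` to `∏_j f_j(t_{1j}, …, t_{dj})`, where `t_{lj}` is the `j`-th diagonal entry of the
`l`-th matrix. -/
def tensorHom : TensorPow k n d →ₐ[k] CartanRing k n d :=
  PiTensorProduct.liftAlgHom
    ((MultilinearMap.mkPiAlgebra k (Fin n) (CartanRing k n d)).compLinearMap fun j =>
      (MvPolynomial.rename (R := k) fun l : Fin d => (l, j)).toLinearMap)
    (by simp) (fun x y => by simp [Finset.prod_mul_distrib])

theorem tensorHom_tprod (f : Fin n → MvPolynomial (Fin d) k) :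
    tensorHom k n d (PiTensorProduct.tprod k f) =
      ∏ j, MvPolynomial.rename (fun l => (l, j)) (f j) :=
  PiTensorProduct.lift.tprod _

theorem tensorHom_single (j : Fin n) (f : MvPolynomial (Fin d) k) :
    tensorHom k n d (PiTensorProduct.singleAlgHom j f) =
      MvPolynomial.rename (fun l => (l, j)) f := by
  rw [PiTensorProduct.singleAlgHom_apply, tensorHom_tprod, Finset.prod_eq_single j]
  · simp
  · intro b _ hb
    simp [Pi.mulSingle_eq_of_ne hb]
  · simp

/-- The identification `k[v_1, …, v_d]^{⊗ n} ≃ k[𝔱^d]`. -/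
def tensorEquiv : TensorPow k n d ≃ₐ[k] CartanRing k n d :=
  AlgEquiv.ofAlgHom (tensorHom k n d)
    (MvPolynomial.aeval fun p => PiTensorProduct.singleAlgHom p.2 (MvPolynomial.X p.1))
    (by
      apply MvPolynomial.algHom_ext
      rintro ⟨l, j⟩
      rw [AlgHom.comp_apply, MvPolynomial.aeval_X, tensorHom_single]
      simp)
    (by
      apply PiTensorProduct.algHom_ext
      intro j
      apply MvPolynomial.algHom_ext
      intro l
      rw [AlgHom.comp_apply, AlgHom.comp_apply, tensorHom_single, MvPolynomial.rename_X,
        MvPolynomial.aeval_X]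
      rfl)

theorem tensorEquiv_tprod (f : Fin n → MvPolynomial (Fin d) k) :
    tensorEquiv k n d (PiTensorProduct.tprod k f) =
      ∏ j, MvPolynomial.rename (fun l => (l, j)) (f j) :=
  tensorHom_tprod k n d f

theorem tensorEquiv_tensorAct (σ : Equiv.Perm (Fin n)) (x : TensorPow k n d) :
    tensorEquiv k n d (tensorAct k n d σ x) = weylAct k n d σ (tensorEquiv k n d x) := by
  have h : (tensorHom k n d).comp (tensorAct k n d σ) =
      (weylAct k n d σ).comp (tensorHom k n d) := by
    apply AlgHom.toLinearMap_injective
    apply PiTensorProduct.ext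
    refine MultilinearMap.ext fun f => ?_
    change tensorHom k n d (tensorAct k n d σ (PiTensorProduct.tprod k f)) =
      weylAct k n d σ (tensorHom k n d (PiTensorProduct.tprod k f))
    rw [tensorAct_tprod, tensorHom_tprod, tensorHom_tprod, map_prod]
    refine Fintype.prod_equiv σ.symm _ _ fun j => ?_
    rw [weylAct, MvPolynomial.rename_rename]
    congr 2
    funext l
    simp
  exact DFunLike.congr_fun h x

theorem map_chowRing :
    (chowRing k n d).map (tensorEquiv k n d).toAlgHom = weylInvariants k n d := by
  ext y
  rw [Subalgebra.mem_map, mem_weylInvariants]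
  constructor
  · rintro ⟨x, hx, rfl⟩ σ
    have h := tensorEquiv_tensorAct k n d σ x
    rw [mem_chowRing.mp hx σ] at h
    exact h.symm
  · intro hy
    refine ⟨(tensorEquiv k n d).symm y, mem_chowRing.mpr fun σ => ?_, by simp⟩
    apply (tensorEquiv k n d).injective
    rw [tensorEquiv_tensorAct, AlgEquiv.apply_symm_apply, hy σ]

/-- The identification `(k[v_1, …, v_d]^{⊗ n})^{𝔖_n} ≃ k[𝔱^d]^W`. -/
def chowEquiv : chowRing k n d ≃ₐ[k] weylInvariants k n d :=
  ((tensorEquiv k n d).subalgebraMap (chowRing k n d)).trans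
    (Subalgebra.equivOfEq _ _ (map_chowRing k n d))

theorem specMap_comp {A B C : Type u} [CommRing A] [Algebra k A] [CommRing B] [Algebra k B]
    [CommRing C] [Algebra k C] (φ : A →ₐ[k] B) (ψ : B →ₐ[k] C) :
    specMap (ψ.comp φ) = specMap ψ ≫ specMap φ := by
  apply Over.OverMorphism.ext
  change Spec.map (CommRingCat.ofHom φ.toRingHom ≫ CommRingCat.ofHom ψ.toRingHom) =
    Spec.map (CommRingCat.ofHom ψ.toRingHom) ≫ Spec.map (CommRingCat.ofHom φ.toRingHom)
  exact Spec.map_comp _ _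

theorem specMap_id {A : Type u} [CommRing A] [Algebra k A] :
    specMap (AlgHom.id k A) = 𝟙 (specOver k A) := by
  apply Over.OverMorphism.ext
  exact Spec.map_id _

/-- The identification `𝔱^d // W ≅ Chow_n(𝔸^d)`. -/
def chowIso : cartanQuotient k n d ≅ chow k n d where
  hom := specMap (chowEquiv k n d).toAlgHom
  inv := specMap (chowEquiv k n d).symm.toAlgHom
  hom_inv_id := by
    refine (specMap_comp k _ _).symm.trans (Eq.trans ?_ (specMap_id k))
    congr 1
    ext x
    simp
  inv_hom_id := by
    refine (specMap_comp k _ _).symm.trans (Eq.trans ?_ (specMap_id k))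
    congr 1
    ext x
    simp

/-! ### Evaluation at commuting matrices -/

variable {n d}

open scoped IsMulCommutative in
/-- The homomorphism of `k`-algebras `Sym(α) : k[v_1, …, v_d] → 𝔤𝔩_n(R)`, `v_i ↦ α_i`, defined
by commuting matrices `α_1, …, α_d`. It is evaluation in the commutative subalgebra generated by
the `α_i`. -/
def symHom {R : Type u} [CommRing R] [Algebra k R] (α : Fin d → Matrix (Fin n) (Fin n) R)
    (hα : ∀ i j, α i * α j = α j * α i) :
    MvPolynomial (Fin d) k →ₐ[k] Matrix (Fin n) (Fin n) R :=
  have : IsMulCommutative (Algebra.adjoin k (Set.range α)) :=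
    Algebra.isMulCommutative_adjoin k (by rintro _ ⟨i, rfl⟩ _ ⟨j, rfl⟩; exact hα i j)
  (Algebra.adjoin k (Set.range α)).val.comp
    (MvPolynomial.aeval fun i => ⟨α i, Algebra.subset_adjoin ⟨i, rfl⟩⟩)

theorem symHom_X {R : Type u} [CommRing R] [Algebra k R] (α : Fin d → Matrix (Fin n) (Fin n) R)
    (hα : ∀ i j, α i * α j = α j * α i) (i : Fin d) :
    symHom k α hα (MvPolynomial.X i) = α i := by
  simp [symHom]

end CommutingScheme

end

/-! In characteristic zero the tensors f^{⊗n} span the symmetric tensors (`span_tensorPow`, by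
polarization), so a linear map on them is determined by f^{⊗n} ↦ det Sym(α)(f). Such a map exists
because the determinant is multilinear in the rows (`detForm`), and it is a ring homomorphism
(`chowPoint`) because det is multiplicative. The universal commuting matrices give `univPoint`,
hence sd. Its behaviour at R-points, on diagonal matrices and under conjugation is checked on the
f^{⊗n} alone.

The hard part is that every invariant function on ℭ comes from a symmetric tensor
(`mem_range_univPoint`). Since ℭ is not known to be reduced, the argument works in the coordinate
ring itself, using Cayley's Omega process. Multiplied by a large power det(g)^m, the coaction of any
function becomes a linear combination of products of m determinants whose rows are rows of matrices
g·Y, with Y a polynomial in the universal matrices (`exists_rowMatrix_monomial`). Applying Ω^m in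
the variable g to such a product contracts Levi-Civita symbols and leaves polynomials in traces of
products of the Y (`omega_prod_det_rowMatrix`); these traces lie in the image of `univPoint`
(`trace_mem_range_chowPoint`). For an invariant f the same expression is det(g)^m f, and Ω^m sends
it to a nonzero integer times f (`omegaConst_ne_zero`).

Consequently `spectralHom` is a left inverse of restriction on invariants. So k[ℭ]^G embeds in a
polynomial ring and is reduced. -/

namespace CommutingScheme

/-! ### Full contractions of matrices along a permutation -/

section Contraction

variable {N A : Type*} [Fintype N] [DecidableEq N] [CommRing A]

/-- A full contraction of matrices from a submonoid `M` lies in every subring that contains the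
traces of the elements of `M`. -/
theorem sum_prod_apply_perm_mem (B : Subring A) (M : Submonoid (Matrix N N A))
    (hM : ∀ y ∈ M, y.trace ∈ B) (ι : Type*) [Fintype ι] [DecidableEq ι] (κ : Equiv.Perm ι)
    (Y : ι → Matrix N N A) (hY : ∀ t, Y t ∈ M) :
    ∑ w : ι → N, ∏ t, Y t (w (κ t)) (w t) ∈ B := by
  suffices h : ∀ [DecidableEq ι] (κ : Equiv.Perm ι) (Y : ι → Matrix N N A), (∀ t, Y t ∈ M) →
      ∑ w : ι → N, ∏ t, Y t (w (κ t)) (w t) ∈ B from h κ Y hY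
  refine Fintype.induction_empty_option (P := fun ι [Fintype ι] => ∀ [DecidableEq ι]
    (κ : Equiv.Perm ι) (Y : ι → Matrix N N A), (∀ t, Y t ∈ M) →
      ∑ w : ι → N, ∏ t, Y t (w (κ t)) (w t) ∈ B) ?_ ?_ ?_ ι
  · intro α β _ e ih _ κ Y hY
    classical
    let _ : Fintype α := Fintype.ofEquiv β e.symm
    convert ih ((e.trans κ).trans e.symm) (fun t => Y (e t)) (fun t => hY _) using 1
    refine Fintype.sum_equiv (Equiv.arrowCongr e.symm (Equiv.refl N)) _ _ fun w => ?_
    refine (Fintype.prod_equiv e _ _ fun t => ?_).symm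
    simp
  · intro _ κ Y _
    simp
  · intro α _ ih _ κ Y hY
    classical
    rw [Fintype.sum_equiv Equiv.piOptionEquivProd _
      (fun p : N × (α → N) => ∏ t, Y t (Option.rec p.1 p.2 (κ t)) (Option.rec p.1 p.2 t)) ?_]
    swap
    · intro w
      refine Finset.prod_congr rfl fun t _ => ?_
      have : ∀ o : Option α, w o = Option.rec (w none) (fun a => w (some a)) o := by
        rintro (_ | _) <;> rfl
      rw [this (κ t), this t]
      rfl
    rw [Fintype.sum_prod_type]
    simp only [Fintype.prod_option]
    -- The sum is the product, over the cycles of κ, of traces of products of the Y's; one index is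
    -- removed at a time. A fixed point `none` splits off the factor tr(Y none).
    by_cases h0 : κ none = none
    · have hs : ∀ a, κ (some a) = some (κ.removeNone a) := fun a => by
        rw [Equiv.removeNone_some]
        refine Option.ne_none_iff_exists'.mp fun h => ?_
        exact Option.some_ne_none a (κ.injective (h.trans h0.symm))
      simp only [h0, hs]
      rw [← Finset.sum_mul_sum]
      exact mul_mem (hM _ (hY none)) (ih _ _ fun t => hY _)
    -- Otherwise the cycle runs x ↦ none ↦ b. Summing over w(none) is a matrix multiplication, so
    -- `none` is deleted from its cycle and Y x is replaced by Y none * Y x.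
    · obtain ⟨b, hb⟩ := Option.ne_none_iff_exists'.mp h0
      obtain ⟨x, hx⟩ : ∃ x, κ (some x) = none := by
        obtain ⟨o, ho⟩ := κ.surjective none
        cases o with
        | none => exact absurd ho h0
        | some x => exact ⟨x, ho⟩
      have hrx : κ.removeNone x = b := by
        have := Equiv.removeNone_none κ hx
        rw [hb] at this
        exact Option.some_injective _ this
      have hs : ∀ a, a ≠ x → κ (some a) = some (κ.removeNone a) := fun a ha => by
        rw [Equiv.removeNone_some]
        refine Option.ne_none_iff_exists'.mp fun h => ha ?_
        exact Option.some_injective _ (κ.injective (h.trans hx.symm))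
      rw [Finset.sum_comm]
      convert ih κ.removeNone (Function.update (fun a => Y (some a)) x (Y none * Y (some x))) ?_
        using 1
      · refine Finset.sum_congr rfl fun w _ => ?_
        rw [← Finset.mul_prod_erase _ _ (Finset.mem_univ x), Function.update_self,
          Matrix.mul_apply, Finset.sum_mul]
        refine Finset.sum_congr rfl fun c _ => ?_
        rw [← Finset.mul_prod_erase _ _ (Finset.mem_univ x), hx, hb, hrx, ← mul_assoc]
        congr 1
        refine Finset.prod_congr rfl fun a ha => ?_
        rw [Function.update_of_ne (Finset.ne_of_mem_erase ha), hs a (Finset.ne_of_mem_erase ha)]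
      · intro t
        by_cases ht : t = x
        · subst ht
          rw [Function.update_self]
          exact mul_mem (hY _) (hY _)
        · rw [Function.update_of_ne ht]
          exact hY _

end Contraction

/-! ### The Levi-Civita symbol -/

section LeviCivita

variable {ι N A : Type*} [Fintype ι] [Fintype N] [DecidableEq N] [CommRing A]

/-- The Levi-Civita symbol: the sign of `w` if `w` is a permutation, and `0` otherwise. -/
def leviCivita (w : N → N) : ℤ := (Matrix.of fun i j => if w i = j then (1 : ℤ) else 0).det

theorem leviCivita_id : leviCivita (id : N → N) = 1 := by
  rw [leviCivita, ← Matrix.det_one (n := N)]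
  congr 1
  ext i j
  simp [Matrix.one_apply]

theorem det_eq_sum_leviCivita (M : Matrix N N A) :
    M.det = ∑ w : N → N, (leviCivita w : A) * ∏ i, M i (w i) := by
  have h : M = fun i => ∑ j, M i j • (Pi.single j 1 : N → A) := by
    ext i j
    simp [Finset.sum_apply, Pi.single_apply]
  conv_lhs => rw [h]
  change Matrix.detRowAlternating.toMultilinearMap _ = _
  rw [MultilinearMap.map_sum]
  refine Finset.sum_congr rfl fun w _ => ?_
  rw [MultilinearMap.map_smul_univ, smul_eq_mul, mul_comm, leviCivita, Int.cast_det]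
  refine congrArg₂ (· * ·) (congrArg Matrix.det (Matrix.ext fun i j => ?_)) rfl
  simp [Pi.single_apply, eq_comm]

/-- The product over `s` of the Levi-Civita symbols of `w (s, ·)`. -/
def leviCivitaProd (w : ι × N → N) : ℤ := ∏ s, leviCivita fun i => w (s, i)

theorem prod_det_eq_sum [DecidableEq ι] (M : ι → Matrix N N A) :
    ∏ s, (M s).det = ∑ w : ι × N → N, (leviCivitaProd w : A) * ∏ t, M t.1 t.2 (w t) := by
  simp only [det_eq_sum_leviCivita, Finset.prod_univ_sum, Fintype.piFinset_univ]
  refine (Fintype.sum_equiv (Equiv.curry ι N N) _ _ fun w => ?_).symm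
  rw [Finset.prod_mul_distrib, Fintype.prod_prod_type, leviCivitaProd]
  push_cast
  rfl

/-- Contraction of two epsilon symbols: the product is the determinant of P_w P_vᵀ, whose (i, j)
entry is 1 if w i = v j and 0 otherwise. Expanding it gives the sum over θ. -/
theorem leviCivita_mul (w v : N → N) :
    leviCivita w * leviCivita v =
      ∑ θ : Equiv.Perm N, (Equiv.Perm.sign θ : ℤ) * ∏ i, if w (θ i) = v i then 1 else 0 := by
  rw [leviCivita, leviCivita, ← Matrix.det_transpose (Matrix.of fun i j => if v i = j then _ else _),
    ← Matrix.det_mul, Matrix.det_apply']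
  refine Finset.sum_congr rfl fun θ _ => ?_
  congr 1
  refine Finset.prod_congr rfl fun i _ => ?_
  simp [Matrix.mul_apply, eq_comm]

theorem leviCivitaProd_mul [DecidableEq ι] (w v : ι × N → N) :
    leviCivitaProd w * leviCivitaProd v =
      ∑ θ : ι → Equiv.Perm N, (∏ s, (Equiv.Perm.sign (θ s) : ℤ)) *
        if w ∘ Equiv.prodCongrRight θ = v then 1 else 0 := by
  rw [leviCivitaProd, leviCivitaProd, ← Finset.prod_mul_distrib]
  simp only [leviCivita_mul, Finset.prod_univ_sum, Fintype.piFinset_univ]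
  refine Finset.sum_congr rfl fun θ _ => ?_
  rw [Finset.prod_mul_distrib]
  congr 1
  simp only [Finset.prod_boole, Finset.mem_univ, true_imp_iff]
  refine if_congr ?_ rfl rfl
  rw [funext_iff, Prod.forall]
  rfl

end LeviCivita

/-! ### Polarized coefficient extraction -/

section Polar

variable {X S A : Type*} [DecidableEq X] [Fintype S] [DecidableEq S] [CommRing A]

/-- The linear form on polynomials given by applying the differential operator
`∏ s, ∂ / ∂ x_{y s}` to the homogeneous component of degree `#S`. -/
noncomputable def polarCoeff (y : S → X) : MvPolynomial X A →ₗ[A] A :=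
  MvPolynomial.lcoeff A (∑ s : S, Finsupp.single s 1) ∘ₗ
    (MvPolynomial.aeval fun x =>
      ∑ s : S, if y s = x then (MvPolynomial.X s : MvPolynomial S A) else 0).toLinearMap

/-- Expanding the substituted product gives the monomials ∏ X_{f t} with y ∘ f = z. Such a monomial
is the squarefree ∏ X_s exactly when f is bijective. -/
theorem polarCoeff_prod_X (y z : S → X) :
    polarCoeff y (∏ t, MvPolynomial.X (z t) : MvPolynomial X A) =
      ∑ π : Equiv.Perm S, if y ∘ π = z then 1 else 0 := by
  have h1 : polarCoeff y (∏ t, MvPolynomial.X (z t) : MvPolynomial X A) =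
      ∑ f : S → S, if Function.Bijective f ∧ y ∘ f = z then 1 else 0 := by
    simp only [polarCoeff, LinearMap.comp_apply, AlgHom.toLinearMap_apply, map_prod,
      MvPolynomial.aeval_X, Finset.prod_univ_sum, Fintype.piFinset_univ, map_sum,
      MvPolynomial.lcoeff_apply]
    refine Finset.sum_congr rfl fun f _ => ?_
    have h2 : ∏ t, (if y (f t) = z t then (MvPolynomial.X (f t) : MvPolynomial S A) else 0) =
        if y ∘ f = z then MvPolynomial.monomial (∑ t, Finsupp.single (f t) 1) 1 else 0 := by
      split_ifs with h
      · subst h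
        rw [MvPolynomial.monomial_sum_one]
        exact Finset.prod_congr rfl fun t _ => if_pos rfl
      · obtain ⟨t, ht⟩ := Function.ne_iff.mp h
        exact Finset.prod_eq_zero (Finset.mem_univ t) (if_neg ht)
    rw [h2]
    have h3 : (∑ t, Finsupp.single (f t) 1 : S →₀ ℕ) = ∑ s, Finsupp.single s 1 ↔
        Function.Bijective f := by
      constructor
      · intro h
        refine Finite.surjective_iff_bijective.mp fun s => ?_
        have h4 := DFunLike.congr_fun h s
        by_contra hs
        push Not at hs
        simp [Finsupp.finsetSum_apply, Finsupp.single_apply, hs] at h4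
      · intro h
        exact Fintype.sum_bijective f h _ _ fun _ => rfl
    by_cases hz : y ∘ f = z
    · simp [hz, MvPolynomial.coeff_monomial, h3]
    · simp [hz]
  rw [h1, ← Finset.sum_filter_of_ne (p := Function.Bijective)]
  · symm
    refine Finset.sum_bij (fun (π : Equiv.Perm S) _ => (π : S → S)) ?_ ?_ ?_ ?_
    · intro π _
      simp
    · intro π _ π' _ h
      exact DFunLike.coe_injective h
    · intro f hf
      exact ⟨Equiv.ofBijective f (Finset.mem_filter.mp hf).2, Finset.mem_univ _, rfl⟩
    · intro π _
      simp
  · intro f _ hf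
    by_contra h
    exact hf (if_neg fun h' => h h'.1)

end Polar

/-! ### Cayley's Omega process -/

section Omega

variable {ι N A : Type*} [Fintype ι] [DecidableEq ι] [Fintype N] [DecidableEq N] [CommRing A]

variable (ι N A) in
/-- The linear form on polynomials in the entries of an `N × N` matrix obtained by applying the
power of Cayley's Omega operator with exponent `#ι` and evaluating at `0`. -/
noncomputable def omega : MvPolynomial (N × N) A →ₗ[A] A :=
  ∑ w : ι × N → N, (leviCivitaProd w : A) • polarCoeff fun t : ι × N => (t.2, w t)

/-- Each π matches the variables with the derivatives. The row condition involves π alone, so it is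
separated from the column condition, which carries the Levi-Civita sum. -/
theorem omega_prod_X (r c : ι × N → N) :
    omega ι N A (∏ t, MvPolynomial.X (r t, c t)) =
      ∑ π : Equiv.Perm (ι × N), if (fun t => (π t).2) = r then
        ((∑ v : ι × N → N, leviCivitaProd v * if v ∘ π = c then 1 else 0 : ℤ) : A) else 0 := by
  simp only [omega, LinearMap.sum_apply, LinearMap.smul_apply, polarCoeff_prod_X, smul_eq_mul,
    Finset.mul_sum]
  rw [Finset.sum_comm]
  refine Finset.sum_congr rfl fun π _ => ?_
  split_ifs with h
  · push_cast
    refine Finset.sum_congr rfl fun v _ => ?_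
    congr 1
    refine if_congr ?_ rfl rfl
    subst h
    simp [funext_iff]
  · refine Finset.sum_eq_zero fun v _ => ?_
    rw [if_neg, mul_zero]
    intro h'
    exact h (funext fun t => congrArg Prod.fst (congrFun h' t))

/-- The matrix whose `i`-th row is the row `r i` of `G * Y i`, where `G` is the generic matrix. -/
noncomputable def rowMatrix (Y : N → Matrix N N A) (r : N → N) :
    Matrix N N (MvPolynomial (N × N) A) :=
  Matrix.of fun i j => ∑ c, MvPolynomial.X (r i, c) * MvPolynomial.C (Y i c j)

/-- One Levi-Civita symbol comes from the determinants (column indices w) and one from Ω (column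
indices v). Their product forces v = w ∘ θ, so only full contractions along the permutations θ ∘ π
remain. -/
theorem omega_prod_det_rowMatrix (Y : ι → N → Matrix N N A) (r : ι → N → N) :
    omega ι N A (∏ s, (rowMatrix (Y s) (r s)).det) =
      ∑ π : Equiv.Perm (ι × N), if (fun t => (π t).2) = (fun t => r t.1 t.2) then
        ∑ θ : ι → Equiv.Perm N, ((∏ s, (Equiv.Perm.sign (θ s) : ℤ) : ℤ) : A) *
          ∑ w : ι × N → N, ∏ t, Y t.1 t.2 (w ((π.trans (Equiv.prodCongrRight θ)) t)) (w t)
      else 0 := by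
  have h1 : ∏ s, (rowMatrix (Y s) (r s)).det =
      ∑ w : ι × N → N, ∑ c : ι × N → N, ((leviCivitaProd w : A) * ∏ t, Y t.1 t.2 (c t) (w t)) •
        ∏ t, (MvPolynomial.X (r t.1 t.2, c t) : MvPolynomial (N × N) A) := by
    rw [prod_det_eq_sum]
    refine Finset.sum_congr rfl fun w _ => ?_
    simp only [rowMatrix, Matrix.of_apply, Finset.prod_univ_sum, Fintype.piFinset_univ,
      Finset.mul_sum]
    refine Finset.sum_congr rfl fun c _ => ?_
    rw [Finset.prod_mul_distrib, MvPolynomial.smul_eq_C_mul]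
    simp only [map_mul, map_prod, map_intCast]
    ring
  rw [h1]
  simp only [map_sum, map_smul, omega_prod_X, smul_eq_mul, Finset.mul_sum]
  refine ((Finset.sum_congr rfl fun w _ => Finset.sum_comm).trans Finset.sum_comm).trans ?_
  refine Finset.sum_congr rfl fun π _ => ?_
  split_ifs with hπ
  swap
  · simp
  have h2 : ∀ w : ι × N → N, ∑ c : ι × N → N,
      ((leviCivitaProd w : A) * ∏ t, Y t.1 t.2 (c t) (w t)) *
        ((∑ v : ι × N → N, leviCivitaProd v * if v ∘ π = c then 1 else 0 : ℤ) : A) =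
      ∑ v : ι × N → N, ((leviCivitaProd w * leviCivitaProd v : ℤ) : A) *
        ∏ t, Y t.1 t.2 (v (π t)) (w t) := fun w => by
    push_cast
    simp only [Finset.mul_sum]
    rw [Finset.sum_comm]
    refine Finset.sum_congr rfl fun v _ => ?_
    rw [Finset.sum_eq_single (v ∘ π)]
    · simp only [if_true, Function.comp_apply]
      ring
    · intro c _ hc
      rw [if_neg hc.symm]
      simp
    · simp
  simp only [h2, leviCivitaProd_mul]
  push_cast
  simp only [Finset.sum_mul]
  refine ((Finset.sum_congr rfl fun w _ => Finset.sum_comm).trans Finset.sum_comm).trans ?_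
  refine Finset.sum_congr rfl fun θ _ => ?_
  refine Finset.sum_congr rfl fun w _ => ?_
  rw [Finset.sum_eq_single (w ∘ Equiv.prodCongrRight θ)]
  · simp
  · intro v _ hv
    rw [if_neg hv.symm]
    simp
  · simp

/-- The first fundamental theorem for matrix invariants, in the form given by the Omega process. -/
theorem omega_prod_det_rowMatrix_mem (B : Subring A) (M : Submonoid (Matrix N N A))
    (hM : ∀ y ∈ M, y.trace ∈ B) (Y : ι → N → Matrix N N A) (hY : ∀ s i, Y s i ∈ M)
    (r : ι → N → N) : omega ι N A (∏ s, (rowMatrix (Y s) (r s)).det) ∈ B := by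
  rw [omega_prod_det_rowMatrix]
  refine sum_mem fun π _ => ?_
  split_ifs
  · refine sum_mem fun θ _ => mul_mem (intCast_mem _ _) ?_
    exact sum_prod_apply_perm_mem B M hM (ι × N) _ (fun t : ι × N => Y t.1 t.2) fun t => hY _ _
  · exact zero_mem _

variable (ι N) in
/-- The value of the Omega process at the power of the determinant with exponent `#ι`. -/
def omegaConst : ℤ := ∑ w : ι × N → N, ∑ v : ι × N → N, ∑ π : Equiv.Perm (ι × N),
  leviCivitaProd w * leviCivitaProd v *
    if (fun t => ((π t).2, v (π t))) = (fun t : ι × N => (t.2, w t)) then 1 else 0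

theorem omega_det_pow : omega ι N A ((Matrix.mvPolynomialX N N A).det ^ Fintype.card ι) =
    (omegaConst ι N : A) := by
  have h : (Matrix.mvPolynomialX N N A).det ^ Fintype.card ι =
      ∏ _s : ι, (Matrix.mvPolynomialX N N A).det := by simp
  rw [h, prod_det_eq_sum, map_sum, omegaConst]
  push_cast
  refine Finset.sum_congr rfl fun w _ => ?_
  have h1 : (leviCivitaProd w : MvPolynomial (N × N) A) = MvPolynomial.C (leviCivitaProd w : A) :=
    (map_intCast _ _).symm
  rw [h1, ← MvPolynomial.smul_eq_C_mul, map_smul]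
  simp only [Matrix.mvPolynomialX_apply]
  simp only [omega, LinearMap.sum_apply, LinearMap.smul_apply, polarCoeff_prod_X, smul_eq_mul,
    Finset.mul_sum, mul_assoc]
  rfl

variable (ι N) in
-- Up to a factorial the constant is the squared norm of the power of det for the pairing given by
-- differentiation. It is therefore a sum of integer squares, not all zero.
theorem omegaConst_ne_zero : omegaConst ι N ≠ 0 := by
  let D : (ι × N → N) → Equiv.Perm (ι × N) → ι × N → N × N := fun v π t => ((π t).2, v (π t))
  have key : (Fintype.card (Equiv.Perm (ι × N)) : ℤ) * omegaConst ι N =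
      ∑ z : ι × N → N × N,
        (∑ w, ∑ π, leviCivitaProd w * if D w π = z then 1 else 0) ^ 2 := by
    -- Replacing π by πρ shows that the sum does not depend on ρ. Averaging over ρ then makes the
    -- expression symmetric in the two factors.
    have e1 : ∀ w v (ρ : Equiv.Perm (ι × N)), ∑ π : Equiv.Perm (ι × N),
        (leviCivitaProd w * leviCivitaProd v * if D v π = D w ρ then 1 else 0) =
        ∑ π : Equiv.Perm (ι × N),
        (leviCivitaProd w * leviCivitaProd v * if D v π = D w 1 then 1 else 0) := by
      intro w v ρ
      refine (Fintype.sum_equiv (Equiv.mulRight ρ) _ _ fun π => ?_).symm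
      congr 1
      refine if_congr ?_ rfl rfl
      constructor
      · intro h
        exact congrArg (· ∘ ρ) h
      · intro h
        have := congrArg (· ∘ ρ.symm) h
        simpa [D, funext_iff] using this
    have e2 : ∑ ρ : Equiv.Perm (ι × N), ∑ w, ∑ v, ∑ π : Equiv.Perm (ι × N),
        (leviCivitaProd w * leviCivitaProd v * if D v π = D w ρ then 1 else 0) =
        (Fintype.card (Equiv.Perm (ι × N)) : ℤ) * omegaConst ι N := by
      simp only [e1]
      rw [Finset.sum_const, Finset.card_univ, nsmul_eq_mul]
      rfl
    rw [← e2]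
    have e3 : ∀ z : ι × N → N × N,
        (∑ w, ∑ π, leviCivitaProd w * if D w π = z then 1 else 0) ^ 2 =
        ∑ ρ : Equiv.Perm (ι × N), ∑ w, ∑ v, ∑ π : Equiv.Perm (ι × N),
          leviCivitaProd w * leviCivitaProd v *
            ((if D v π = z then 1 else 0) * if D w ρ = z then 1 else 0) := by
      intro z
      rw [sq, Finset.sum_mul_sum]
      symm
      refine Finset.sum_comm.trans (Finset.sum_congr rfl fun w _ => ?_)
      refine Finset.sum_comm.trans (Finset.sum_congr rfl fun v _ => ?_)
      rw [Finset.sum_mul_sum]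
      refine Finset.sum_congr rfl fun ρ _ => Finset.sum_congr rfl fun π _ => ?_
      ring
    simp only [e3]
    symm
    refine Finset.sum_comm.trans (Finset.sum_congr rfl fun ρ _ => ?_)
    refine Finset.sum_comm.trans (Finset.sum_congr rfl fun w _ => ?_)
    refine Finset.sum_comm.trans (Finset.sum_congr rfl fun v _ => ?_)
    refine Finset.sum_comm.trans (Finset.sum_congr rfl fun π _ => ?_)
    rw [← Finset.mul_sum]
    congr 1
    rw [Finset.sum_eq_single (D w ρ)]
    · simp
    · intro z _ hz
      simp [hz.symm]
    · simp
  have hpos : 0 < ∑ z : ι × N → N × N,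
      (∑ w, ∑ π, leviCivitaProd w * if D w π = z then 1 else 0) ^ 2 := by
    -- The square for the power of the diagonal monomial ∏ x_{ii} is positive: D w π = z forces w to
    -- be the projection, whose sign is 1, so nothing cancels.
    refine Finset.sum_pos' (fun z _ => sq_nonneg _) ⟨fun t => (t.2, t.2), Finset.mem_univ _, ?_⟩
    have h1 : ∀ w π, (leviCivitaProd w * if D w π = fun t => (t.2, t.2) then 1 else 0) =
        if w = Prod.snd ∧ D w π = (fun t => (t.2, t.2)) then 1 else 0 := by
      intro w π
      by_cases h : D w π = fun t => (t.2, t.2)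
      · have hw : w = Prod.snd := by
          funext s
          have h2 := congrFun h (π.symm s)
          simp only [D, Equiv.apply_symm_apply, Prod.mk.injEq] at h2
          rw [h2.2, h2.1]
        have h3 : leviCivitaProd (Prod.snd : ι × N → N) = 1 :=
          Finset.prod_eq_one fun s _ => leviCivita_id
        simp [hw, h3]
      · simp [h]
    refine pow_pos ?_ 2
    simp only [h1]
    refine Finset.sum_pos' (fun w _ => Finset.sum_nonneg fun π _ => by split_ifs <;> simp)
      ⟨Prod.snd, Finset.mem_univ _, ?_⟩
    refine Finset.sum_pos' (fun π _ => by split_ifs <;> simp) ⟨1, Finset.mem_univ _, ?_⟩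
    rw [if_pos ⟨rfl, rfl⟩]
    exact one_pos
  intro h0
  rw [h0, mul_zero] at key
  exact hpos.ne key

end Omega

section

/-! ### Polarization -/

section Polarization

/-- The polarization identity: the symmetrization of a multilinear map is a combination of its
values on the diagonal. -/
theorem sum_perm_eq_sum_diagonal {ι R M M' : Type*} [Fintype ι] [DecidableEq ι] [CommRing R]
    [AddCommGroup M] [AddCommGroup M'] [Module R M] [Module R M']
    (m : MultilinearMap R (fun _ : ι => M) M') (f : ι → M) :
    ∑ σ : Equiv.Perm ι, m (f ∘ σ) =
      ∑ S : Finset ι, (-1 : ℤ) ^ S.card • m fun _ => ∑ i ∈ Sᶜ, f i := by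
  have h1 : ∀ S : Finset ι, (m fun _ => ∑ i ∈ Sᶜ, f i) =
      ∑ j : ι → ι, if S ⊆ (Finset.univ.image j)ᶜ then m (f ∘ j) else 0 := by
    intro S
    rw [MultilinearMap.map_sum_finset, ← Finset.sum_filter]
    refine Finset.sum_congr ?_ fun _ _ => rfl
    ext j
    simp only [Fintype.mem_piFinset, Finset.mem_compl, Finset.mem_filter, Finset.mem_univ,
      true_and, Finset.subset_iff, Finset.mem_image, not_exists]
    exact ⟨fun h x hx i hi => h i (hi ▸ hx), fun h i hi => h hi i rfl⟩
  -- Inclusion–exclusion: the signs cancel unless j misses no index, so only permutations survive.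
  have h2 : ∀ j : ι → ι, ∑ S : Finset ι, (-1 : ℤ) ^ S.card •
      (if S ⊆ (Finset.univ.image j)ᶜ then m (f ∘ j) else 0) =
      if Function.Surjective j then m (f ∘ j) else 0 := by
    intro j
    have h3 : ∑ S : Finset ι, (-1 : ℤ) ^ S.card •
        (if S ⊆ (Finset.univ.image j)ᶜ then m (f ∘ j) else 0) =
        (∑ S ∈ (Finset.univ.image j)ᶜ.powerset, (-1 : ℤ) ^ S.card) • m (f ∘ j) := by
      rw [Finset.sum_smul, ← Finset.filter_subset_univ, Finset.sum_filter]
      refine Finset.sum_congr rfl fun S _ => ?_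
      split_ifs <;> simp
    rw [h3, Finset.sum_powerset_neg_one_pow_card, ite_smul, one_smul, zero_smul]
    exact if_congr (by rw [Finset.compl_eq_empty_iff, ← Finset.coe_eq_univ,
      Finset.coe_image, Finset.coe_univ, Set.image_univ, Set.range_eq_univ]) rfl rfl
  simp only [h1, Finset.smul_sum]
  rw [Finset.sum_comm]
  simp only [h2]
  rw [← Finset.sum_filter]
  refine Finset.sum_bij (fun (σ : Equiv.Perm ι) _ => (σ : ι → ι)) ?_ ?_ ?_ ?_
  · intro σ _
    simpa using σ.surjective
  · intro σ _ τ _ h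
    exact DFunLike.coe_injective h
  · intro j hj
    exact ⟨Equiv.ofBijective j
      (Finite.surjective_iff_bijective.mp (Finset.mem_filter.mp hj).2), Finset.mem_univ _, rfl⟩
  · intro σ _
    rfl

end Polarization

variable {k : Type u} [Field k] {n d : ℕ}

theorem sum_tensorAct_mem_span (x : TensorPow k n d) :
    ∑ σ : Equiv.Perm (Fin n), tensorAct k n d σ x ∈
      Submodule.span k (Set.range fun f => (tensorPow (k := k) (d := d) n f : TensorPow k n d)) := by
  induction x using PiTensorProduct.induction_on with
  | smul_tprod r f =>
    simp only [map_smul, tensorAct_tprod, ← Finset.smul_sum]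
    refine Submodule.smul_mem _ _ ?_
    have h : ∑ σ : Equiv.Perm (Fin n), PiTensorProduct.tprod k (fun j => f (σ.symm j)) =
        ∑ σ : Equiv.Perm (Fin n), PiTensorProduct.tprod k (f ∘ σ) :=
      Fintype.sum_equiv (Equiv.inv (Equiv.Perm (Fin n))) _ _ fun _ => rfl
    rw [h, sum_perm_eq_sum_diagonal]
    refine sum_mem fun S _ => zsmul_mem (Submodule.subset_span ?_) _
    exact ⟨_, rfl⟩
  | add x y hx hy =>
    simp only [map_add, Finset.sum_add_distrib]
    exact add_mem hx hy

/-- In characteristic zero, the symmetric tensors `f ⊗ ⋯ ⊗ f` span all symmetric tensors. -/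
theorem span_tensorPow [CharZero k] :
    Submodule.span k (Set.range fun f => tensorPow (k := k) (d := d) n f) = ⊤ := by
  rw [eq_top_iff]
  rintro x -
  have h1 := sum_tensorAct_mem_span (x : TensorPow k n d)
  -- On a symmetric tensor the symmetrization is multiplication by n!, which is invertible in k.
  rw [Finset.sum_congr rfl fun σ _ => mem_chowRing.mp x.2 σ, Finset.sum_const, Finset.card_univ,
    ← Nat.cast_smul_eq_nsmul k, Submodule.smul_mem_iff _ (Nat.cast_ne_zero.mpr Fintype.card_ne_zero),
    Set.range_comp' Subtype.val, ← Subalgebra.coe_val, ← AlgHom.coe_toLinearMap,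
    Submodule.span_image] at h1
  obtain ⟨y, hy, hyx⟩ := h1
  rwa [← Subtype.ext (a1 := y) (a2 := x) hyx]

theorem linearMap_ext_tensorPow [CharZero k] {R : Type*} [AddCommGroup R] [Module k R]
    {z z' : chowRing k n d →ₗ[k] R} (h : ∀ f, z (tensorPow n f) = z' (tensorPow n f)) : z = z' :=
  LinearMap.ext_on_range span_tensorPow h

theorem tensorPow_mul (f g : MvPolynomial (Fin d) k) :
    tensorPow n (f * g) = tensorPow n f * tensorPow n g :=
  Subtype.ext (PiTensorProduct.tprod_mul_tprod (R := k) (fun _ => f) (fun _ => g)).symm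

/-! ### The determinant of `Sym(α)` -/

section Det

variable {R : Type u} [CommRing R] [Algebra k R] (α : Fin d → Matrix (Fin n) (Fin n) R)
  (hα : ∀ i j, α i * α j = α j * α i)

theorem map_symHom {R' : Type u} [CommRing R'] [Algebra k R'] (φ : R →ₐ[k] R')
    (α' : Fin d → Matrix (Fin n) (Fin n) R') (hα' : ∀ i j, α' i * α' j = α' j * α' i)
    (h : ∀ l, (α l).map φ = α' l) (f : MvPolynomial (Fin d) k) :
    (symHom k α hα f).map φ = symHom k α' hα' f := by
  have : φ.mapMatrix.comp (symHom k α hα) = symHom k α' hα' := by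
    apply MvPolynomial.algHom_ext
    intro l
    rw [AlgHom.comp_apply, symHom_X, symHom_X, ← h]
    rfl
  exact DFunLike.congr_fun this f

/-- The linear form on `k[v_1, …, v_d]^{⊗ n}` sending `f_1 ⊗ ⋯ ⊗ f_n` to the determinant of the
matrix whose `i`-th row is the `i`-th row of `Sym(α)(f_i)`. -/
noncomputable def detForm : TensorPow k n d →ₗ[k] R :=
  PiTensorProduct.lift
    (((Matrix.detRowAlternating (n := Fin n) (R := R)).toMultilinearMap.restrictScalars k
      ).compLinearMap fun i => LinearMap.proj (R := k) (φ := fun _ : Fin n => Fin n → R) i ∘ₗ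
        (Matrix.ofLinearEquiv k).symm.toLinearMap ∘ₗ (symHom k α hα).toLinearMap)

theorem detForm_tprod (f : Fin n → MvPolynomial (Fin d) k) :
    detForm α hα (PiTensorProduct.tprod k f) =
      (Matrix.of fun i => symHom k α hα (f i) i).det :=
  PiTensorProduct.lift.tprod _

theorem detForm_tensorPow (f : MvPolynomial (Fin d) k) :
    detForm (k := k) α hα (tensorPow n f) = (symHom k α hα f).det :=
  detForm_tprod α hα _

/-- The homomorphism `(k[v_1, …, v_d]^{⊗ n})^{𝔖_n} → R` sending `f ⊗ ⋯ ⊗ f` to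
`det (Sym(α)(f))`. -/
noncomputable def chowPoint [CharZero k] : chowRing k n d →ₐ[k] R :=
  AlgHom.ofLinearMap (detForm α hα ∘ₗ (chowRing k n d).val.toLinearMap)
    (by
      change detForm (k := k) α hα (tensorPow (k := k) (d := d) n 1) = 1
      rw [detForm_tensorPow, map_one, Matrix.det_one])
    (by
      -- Both sides are bilinear on symmetric tensors, so powers f^{⊗n}, g^{⊗n} suffice.
      rw [LinearMap.map_mul_iff]
      refine linearMap_ext_tensorPow fun f => linearMap_ext_tensorPow fun g => ?_
      change detForm (k := k) α hα (tensorPow n f * tensorPow n g : chowRing k n d) =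
        detForm (k := k) α hα (tensorPow n f) * detForm (k := k) α hα (tensorPow n g)
      rw [← tensorPow_mul, detForm_tensorPow, detForm_tensorPow, detForm_tensorPow, map_mul,
        Matrix.det_mul])

theorem chowPoint_tensorPow [CharZero k] (f : MvPolynomial (Fin d) k) :
    chowPoint α hα (tensorPow n f) = (symHom k α hα f).det :=
  detForm_tensorPow α hα f

theorem chowPoint_unique [CharZero k] (z : chowRing k n d →ₗ[k] R)
    (hz : ∀ f, z (tensorPow n f) = (symHom k α hα f).det) :
    z = (chowPoint α hα).toLinearMap :=
  linearMap_ext_tensorPow fun f => (hz f).trans (chowPoint_tensorPow α hα f).symm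

theorem comp_chowPoint [CharZero k] {R' : Type u} [CommRing R'] [Algebra k R'] (φ : R →ₐ[k] R')
    (α' : Fin d → Matrix (Fin n) (Fin n) R') (hα' : ∀ i j, α' i * α' j = α' j * α' i)
    (h : ∀ l, (α l).map φ = α' l) : φ.comp (chowPoint α hα) = chowPoint α' hα' := by
  apply AlgHom.toLinearMap_injective
  refine chowPoint_unique α' hα' _ fun f => ?_
  change φ (chowPoint α hα (tensorPow n f)) = _
  rw [chowPoint_tensorPow, AlgHom.map_det, ← map_symHom α hα φ α' hα' h]
  rfl

/-- The trace of `Sym(α)(f)` is the image of a symmetric tensor. -/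
theorem trace_mem_range_chowPoint [CharZero k] (f : MvPolynomial (Fin d) k) :
    (symHom k α hα f).trace ∈ (chowPoint (k := k) α hα).range := by
  -- The witness is ∑_j 1 ⊗ ⋯ ⊗ f ⊗ ⋯ ⊗ 1. Its j-th term maps to the determinant of the identity
  -- with row j replaced by row j of Sym(α)(f), which is the j-th diagonal entry.
  have hmem : ∑ j, PiTensorProduct.tprod k (Pi.mulSingle j f : Fin n → MvPolynomial (Fin d) k) ∈
      chowRing k n d := by
    rw [mem_chowRing]
    intro σ
    rw [map_sum]
    refine Fintype.sum_equiv σ _ _ fun j => ?_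
    rw [tensorAct_tprod]
    congr 1
    funext i
    simp [Pi.mulSingle_apply, Equiv.symm_apply_eq]
  refine ⟨⟨_, hmem⟩, ?_⟩
  change detForm (k := k) α hα (∑ j, PiTensorProduct.tprod k (Pi.mulSingle j f)) = _
  rw [map_sum, Matrix.trace]
  refine Finset.sum_congr rfl fun j _ => ?_
  rw [detForm_tprod, Matrix.diag_apply]
  have h : (Matrix.of fun i => symHom k α hα ((Pi.mulSingle j f : Fin n → _) i) i) =
      Matrix.updateRow 1 j (symHom k α hα f j) := by
    ext a b
    by_cases ha : a = j
    · subst ha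
      simp
    · simp [ha]
  rw [h]
  have h2 := Matrix.cramer_transpose_apply (1 : Matrix (Fin n) (Fin n) R) (symHom k α hα f j) j
  rw [← h2]
  simp

end Det

/-! ### The universal spectral datum -/

variable [CharZero k]

variable (k n d) in
/-- The homomorphism `(k[v_1, …, v_d]^{⊗ n})^{𝔖_n} → k[ℭ]` sending `f ⊗ ⋯ ⊗ f` to the determinant
of `f` evaluated at the universal commuting matrices. -/
noncomputable def univPoint : chowRing k n d →ₐ[k] CoordRing k n d :=
  chowPoint (univMatrix k n d) (univMatrix_comm k n d)

theorem point_comp_univPoint {R : Type u} [CommRing R] [Algebra k R]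
    (α : Fin d → Matrix (Fin n) (Fin n) R) (hα : ∀ i j, α i * α j = α j * α i) :
    (point α hα).comp (univPoint k n d) = chowPoint α hα :=
  comp_chowPoint _ _ _ _ _ (point_univMatrix α hα)

theorem restrict_comp_univPoint :
    (restrict k n d).comp (univPoint k n d) =
      (tensorEquiv k n d).toAlgHom.comp (chowRing k n d).val := by
  rw [restrict, point_comp_univPoint]
  apply AlgHom.toLinearMap_injective
  symm
  refine chowPoint_unique _ _ _ fun f => ?_
  change tensorEquiv k n d (PiTensorProduct.tprod k fun _ => f) = _
  rw [tensorEquiv_tprod]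
  have h : symHom k (cartanMatrix k n d) (cartanMatrix_comm k n d) f =
      Matrix.diagonal fun j => MvPolynomial.rename (fun l => (l, j)) f := by
    have : symHom k (cartanMatrix k n d) (cartanMatrix_comm k n d) =
        (Matrix.diagonalAlgHom k).comp
          (AlgHom.pi fun j => MvPolynomial.rename fun l : Fin d => (l, j)) := by
      apply MvPolynomial.algHom_ext
      intro l
      rw [symHom_X]
      change Matrix.diagonal _ = Matrix.diagonal _
      congr 1
      funext j
      exact (MvPolynomial.rename_X (R := k) (fun l : Fin d => (l, j)) l).symm
    rw [this]
    rfl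
  rw [h, Matrix.det_diagonal]

/-- Sym(gαg⁻¹) is the conjugate of Sym(α) by g, and the determinant does not see conjugation. -/
theorem coaction_comp_univPoint :
    (coaction k n d).comp (univPoint k n d) =
      (Algebra.TensorProduct.includeRight : CoordRing k n d →ₐ[k] GLTensor k n d).comp
        (univPoint k n d) := by
  have hr : (Algebra.TensorProduct.includeRight : CoordRing k n d →ₐ[k] GLTensor k n d).comp
      (univPoint k n d) = chowPoint (actX k n d) (actX_comm k n d) :=
    comp_chowPoint _ _ _ _ _ fun _ => rfl
  rw [hr, coaction, point_comp_univPoint]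
  apply AlgHom.toLinearMap_injective
  refine chowPoint_unique _ _ _ fun f => ?_
  have hG := isUnit_det_actG k n d
  change chowPoint _ _ (tensorPow n f) = _
  rw [chowPoint_tensorPow, ← Matrix.det_conj ((Matrix.isUnit_iff_isUnit_det _).mpr hG)
    (symHom k (actX k n d) _ f)]
  congr 1
  let c : Matrix (Fin n) (Fin n) (GLTensor k n d) →ₐ[k] Matrix (Fin n) (Fin n) (GLTensor k n d) :=
    AlgHom.ofLinearMap ((LinearMap.mulRight k (actG k n d)⁻¹) ∘ₗ LinearMap.mulLeft k (actG k n d))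
      (by simp [Matrix.mul_nonsing_inv _ hG])
      (fun x y => by
        simp only [LinearMap.comp_apply, LinearMap.mulLeft_apply, LinearMap.mulRight_apply]
        calc actG k n d * (x * y) * (actG k n d)⁻¹ =
            actG k n d * x * 1 * y * (actG k n d)⁻¹ := by
              simp only [Matrix.mul_assoc, Matrix.one_mul]
          _ = _ := by
            rw [← Matrix.nonsing_inv_mul _ hG]
            simp only [Matrix.mul_assoc])
  have : symHom k _ (conj_comm hG (actX_comm k n d)) =
      c.comp (symHom k (actX k n d) (actX_comm k n d)) := by
    apply MvPolynomial.algHom_ext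
    intro l
    rw [AlgHom.comp_apply, symHom_X, symHom_X]
    rfl
  rw [this]
  rfl

end

section

/-! ### Invariant functions on the commuting scheme -/

/-- Cramer's rule gives the (a, b) entry of G H adj(G). Thus one factor det G turns an entry of a
conjugate into a single determinant built from rows of G and G H. -/
theorem det_updateRow_eq_det_mul_conj {N T : Type*} [Fintype N] [DecidableEq N] [CommRing T]
    {G : Matrix N N T} (hG : IsUnit G.det) (H : Matrix N N T) (a b : N) :
    (G.updateRow b ((G * H) a)).det = G.det * (G * H * G⁻¹) a b := by
  have h1 : G.det • (G * H * G⁻¹) = G * H * G.adjugate := by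
    rw [Matrix.inv_def, Matrix.mul_smul, smul_smul, Ring.mul_inverse_cancel _ hG, one_smul]
  rw [← smul_eq_mul (G.det), ← Matrix.smul_apply, h1, ← Matrix.cramer_transpose_apply,
    Matrix.cramer_eq_adjugate_mulVec, ← Matrix.adjugate_transpose, Matrix.mulVec_transpose]
  rfl

variable {k : Type u} [Field k] {n d : ℕ}

variable (k n d) in
/-- The homomorphism `k[ℭ][g_{ab}] → k[GL_n] ⊗ k[ℭ]`. -/
noncomputable def genericHom :
    MvPolynomial (Fin n × Fin n) (CoordRing k n d) →+* GLTensor k n d :=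
  MvPolynomial.eval₂Hom
    (Algebra.TensorProduct.includeRight : CoordRing k n d →ₐ[k] GLTensor k n d).toRingHom
    fun p => actG k n d p.1 p.2

theorem genericHom_C (x : CoordRing k n d) :
    genericHom k n d (MvPolynomial.C x) = Algebra.TensorProduct.includeRight x :=
  MvPolynomial.eval₂Hom_C _ _ _

theorem genericHom_X (p : Fin n × Fin n) :
    genericHom k n d (MvPolynomial.X p) = actG k n d p.1 p.2 :=
  MvPolynomial.eval₂Hom_X' _ _ _

theorem genericHom_det :
    genericHom k n d (Matrix.mvPolynomialX (Fin n) (Fin n) (CoordRing k n d)).det =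
      (actG k n d).det := by
  rw [RingHom.map_det]
  congr 1
  ext a b
  exact genericHom_X (a, b)

theorem injective_algebraMap_GLRing :
    Function.Injective (algebraMap (MvPolynomial (Fin n × Fin n) k) (GLRing k n)) :=
  IsLocalization.injective (M := Submonoid.powers (Matrix.mvPolynomialX (Fin n) (Fin n) k).det) _
    (powers_le_nonZeroDivisors_of_noZeroDivisors (Matrix.det_mvPolynomialX_ne_zero _ _))

/-- Inverting the nonzero det is injective on k[g_{ab}], and tensoring with k[ℭ] over a field
preserves this. Identities that need g⁻¹ can thus be pulled back to polynomials in g, where `omega`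
is defined. -/
theorem genericHom_injective : Function.Injective (genericHom k n d) := by
  let ψ : MvPolynomial (Fin n × Fin n) k →ₐ[k] GLRing k n := Algebra.ofId _ _ |>.restrictScalars k
  let J : MvPolynomial (Fin n × Fin n) (CoordRing k n d) →+* GLTensor k n d :=
    (Algebra.TensorProduct.map ψ (AlgHom.id k (CoordRing k n d))).toRingHom.comp
      ((Algebra.TensorProduct.comm k (CoordRing k n d) _).toRingEquiv.toRingHom.comp
        (MvPolynomial.algebraTensorAlgEquiv k (CoordRing k n d)).symm.toRingEquiv.toRingHom)
  have hJ : genericHom k n d = J := by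
    apply MvPolynomial.ringHom_ext
    · intro x
      have h : (MvPolynomial.algebraTensorAlgEquiv k (CoordRing k n d)).symm
          (MvPolynomial.C x : MvPolynomial (Fin n × Fin n) _) = x ⊗ₜ[k] 1 :=
        (MvPolynomial.algebraTensorAlgEquiv k (CoordRing k n d)).symm.commutes x
      rw [genericHom_C]
      simp [J, h]
    · intro p
      rw [genericHom_X]
      simp [J, ψ, actG, glMatrix]
  rw [hJ]
  have h1 : Function.Injective (Algebra.TensorProduct.map ψ (AlgHom.id k (CoordRing k n d))) :=
    Module.Flat.rTensor_preserves_injective_linearMap (M := CoordRing k n d) ψ.toLinearMap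
      injective_algebraMap_GLRing
  exact h1.comp ((Algebra.TensorProduct.comm k (CoordRing k n d) _).injective.comp
    (MvPolynomial.algebraTensorAlgEquiv k (CoordRing k n d)).symm.injective)

theorem genericHom_det_rowMatrix (Y : Fin n → Matrix (Fin n) (Fin n) (CoordRing k n d))
    (r : Fin n → Fin n) :
    genericHom k n d (rowMatrix Y r).det = (Matrix.of fun i j => (actG k n d * (Y i).map
      (Algebra.TensorProduct.includeRight : CoordRing k n d →ₐ[k] GLTensor k n d)) (r i) j).det := by
  rw [RingHom.map_det]
  congr 1
  ext i j
  simp [rowMatrix, Matrix.mul_apply, genericHom_C, genericHom_X]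

theorem coaction_X (l : Fin d) (a b : Fin n) :
    coaction k n d (toCoordRing k n d (MvPolynomial.X (l, a, b))) =
      (actG k n d * actX k n d l * (actG k n d)⁻¹) a b :=
  congrFun (congrFun (point_univMatrix (k := k)
    (fun l => actG k n d * actX k n d l * (actG k n d)⁻¹)
    (conj_comm (isUnit_det_actG k n d) (actX_comm k n d)) l) a) b

variable (k n d) in
/-- The monoid of matrices over `k[ℭ]` that are polynomials in the universal matrices. -/
noncomputable def symMonoid : Submonoid (Matrix (Fin n) (Fin n) (CoordRing k n d)) :=
  MonoidHom.mrange (symHom k (univMatrix k n d) (univMatrix_comm k n d) :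
    MvPolynomial (Fin d) k →* Matrix (Fin n) (Fin n) (CoordRing k n d))

theorem univMatrix_mem_symMonoid (l : Fin d) : univMatrix k n d l ∈ symMonoid k n d :=
  ⟨MvPolynomial.X l, symHom_X _ _ (univMatrix_comm k n d) _⟩

/-- Each variable of the monomial uses one factor det(g). The claim covers all large m so that
monomials of different degrees can share one exponent. -/
theorem exists_rowMatrix_monomial (e : (Fin d × Fin n × Fin n) →₀ ℕ) (a : k) :
    ∃ m₀, ∀ m, m₀ ≤ m → ∃ (c : k) (Y : Fin m → Fin n → Matrix (Fin n) (Fin n) (CoordRing k n d))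
      (r : Fin m → Fin n → Fin n), (∀ s i, Y s i ∈ symMonoid k n d) ∧
      genericHom k n d (MvPolynomial.C (algebraMap k _ c) * ∏ s, (rowMatrix (Y s) (r s)).det) =
        (actG k n d).det ^ m * coaction k n d (toCoordRing k n d (MvPolynomial.monomial e a)) := by
  refine MvPolynomial.induction_on_monomial (motive := fun F : TupleRing k n d =>
    ∃ m₀, ∀ m, m₀ ≤ m → ∃ (c : k) (Y : Fin m → Fin n → Matrix (Fin n) (Fin n) (CoordRing k n d))
      (r : Fin m → Fin n → Fin n), (∀ s i, Y s i ∈ symMonoid k n d) ∧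
      genericHom k n d (MvPolynomial.C (algebraMap k _ c) * ∏ s, (rowMatrix (Y s) (r s)).det) =
        (actG k n d).det ^ m * coaction k n d (toCoordRing k n d F)) ?_ ?_ e a
  -- Unused factors are plain copies of det(g): all Y are 1 and the rows stay in order.
  · refine fun c => ⟨0, fun m _ => ⟨c, fun _ _ => 1, fun _ => id, fun _ _ => one_mem _, ?_⟩⟩
    have h1 : (Matrix.of fun i j => (actG k n d * (1 : Matrix (Fin n) (Fin n) _).map
        (Algebra.TensorProduct.includeRight : CoordRing k n d →ₐ[k] GLTensor k n d)) (id i) j) =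
        actG k n d := by
      rw [Matrix.map_one _ (map_zero _) (map_one _), Matrix.mul_one]
      rfl
    have h2 : (MvPolynomial.C c : TupleRing k n d) = algebraMap k _ c := rfl
    rw [h2, AlgHom.commutes, AlgHom.commutes, map_mul, map_prod, genericHom_C, AlgHom.commutes]
    simp only [genericHom_det_rowMatrix, h1]
    rw [Finset.prod_const, Finset.card_univ, Fintype.card_fin, mul_comm]
  · rintro F ⟨l, a, b⟩ ⟨m₀, hF⟩
    refine ⟨m₀ + 1, fun m hm => ?_⟩
    obtain ⟨m, rfl⟩ : ∃ m', m = m' + 1 := ⟨m - 1, by omega⟩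
    obtain ⟨c, Y, r, hY, h⟩ := hF m (by omega)
    -- The new determinant is det(g) with row b replaced by row a of g·x_l, as in
    -- `det_updateRow_eq_det_mul_conj`.
    refine ⟨c, Fin.cons (Function.update (fun _ => 1) b (univMatrix k n d l)) Y,
      Fin.cons (Function.update id b a) r, fun s i => ?_, ?_⟩
    · refine Fin.cases ?_ (fun s => ?_) s
      · rw [Fin.cons_zero]
        by_cases hi : i = b
        · subst hi
          rw [Function.update_self]
          exact univMatrix_mem_symMonoid l
        · rw [Function.update_of_ne hi]
          exact one_mem _
      · rw [Fin.cons_succ]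
        exact hY s i
    · rw [Fin.prod_univ_succ]
      simp only [Fin.cons_zero, Fin.cons_succ]
      rw [mul_left_comm, map_mul, h, genericHom_det_rowMatrix]
      have h1 : (Matrix.of fun i j => (actG k n d *
          ((Function.update (fun _ => 1) b (univMatrix k n d l) :
            Fin n → Matrix (Fin n) (Fin n) (CoordRing k n d)) i).map
          (Algebra.TensorProduct.includeRight : CoordRing k n d →ₐ[k] GLTensor k n d))
          (Function.update id b a i) j) =
          (actG k n d).updateRow b ((actG k n d * actX k n d l) a) := by
        ext i j
        by_cases hi : i = b
        · subst hi
          simp [actX]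
        · simp [hi, Matrix.map_one _ (map_zero (Algebra.TensorProduct.includeRight :
            CoordRing k n d →ₐ[k] GLTensor k n d)) (map_one _)]
      rw [h1, det_updateRow_eq_det_mul_conj (isUnit_det_actG k n d), ← coaction_X, map_mul,
        map_mul, pow_succ]
      ring

variable [CharZero k]

theorem trace_mem_range_univPoint {y : Matrix (Fin n) (Fin n) (CoordRing k n d)}
    (hy : y ∈ symMonoid k n d) : y.trace ∈ (univPoint k n d).range := by
  obtain ⟨f, rfl⟩ := hy
  exact trace_mem_range_chowPoint _ _ f

theorem exists_omega_mem (F : TupleRing k n d) :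
    ∃ m₀, ∀ m, m₀ ≤ m → ∃ Q : MvPolynomial (Fin n × Fin n) (CoordRing k n d),
      genericHom k n d Q = (actG k n d).det ^ m * coaction k n d (toCoordRing k n d F) ∧
      omega (Fin m) (Fin n) (CoordRing k n d) Q ∈ (univPoint k n d).range := by
  induction F using MvPolynomial.induction_on' with
  | monomial e a =>
    obtain ⟨m₀, h⟩ := exists_rowMatrix_monomial (k := k) (n := n) (d := d) e a
    refine ⟨m₀, fun m hm => ?_⟩
    obtain ⟨c, Y, r, hY, h⟩ := h m hm
    refine ⟨_, h, ?_⟩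
    rw [← MvPolynomial.smul_eq_C_mul, map_smul, smul_eq_mul]
    exact mul_mem (Subalgebra.algebraMap_mem _ _)
      (omega_prod_det_rowMatrix_mem (univPoint k n d).range.toSubring (symMonoid k n d)
        (fun y hy => trace_mem_range_univPoint hy) Y hY r)
  | add p q hp hq =>
    obtain ⟨m₁, h₁⟩ := hp
    obtain ⟨m₂, h₂⟩ := hq
    refine ⟨max m₁ m₂, fun m hm => ?_⟩
    obtain ⟨Q₁, e₁, o₁⟩ := h₁ m (le_of_max_le_left hm)
    obtain ⟨Q₂, e₂, o₂⟩ := h₂ m (le_of_max_le_right hm)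
    refine ⟨Q₁ + Q₂, ?_, ?_⟩
    · rw [map_add, e₁, e₂, map_add, map_add, mul_add]
    · rw [map_add]
      exact add_mem o₁ o₂

/-- Every invariant function on the commuting scheme comes from a symmetric tensor. -/
theorem mem_range_univPoint {f : CoordRing k n d} (hf : f ∈ invariants k n d) :
    f ∈ (univPoint k n d).range := by
  obtain ⟨F, rfl⟩ : ∃ F, toCoordRing k n d F = f := Ideal.Quotient.mk_surjective f
  obtain ⟨m, hm⟩ := exists_omega_mem F
  obtain ⟨Q, hQ, hmem⟩ := hm m le_rfl
  -- By invariance the coaction is 1 ⊗ f, so injectivity of `genericHom` identifies Q with det^m ·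
  -- f.
  rw [show coaction k n d (toCoordRing k n d F) = _ from hf, ← genericHom_det, ← genericHom_C,
    ← map_pow, ← map_mul] at hQ
  have hdet := omega_det_pow (ι := Fin m) (N := Fin n) (A := CoordRing k n d)
  rw [Fintype.card_fin] at hdet
  rw [genericHom_injective hQ, mul_comm, ← MvPolynomial.smul_eq_C_mul, map_smul, hdet,
    smul_eq_mul] at hmem
  have hc : ((omegaConst (Fin m) (Fin n) : ℤ) : k) ≠ 0 :=
    Int.cast_ne_zero.mpr (omegaConst_ne_zero _ _)
  have h1 := Subalgebra.smul_mem _ hmem ((omegaConst (Fin m) (Fin n) : ℤ) : k)⁻¹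
  rwa [← map_intCast (algebraMap k (CoordRing k n d)), mul_comm, ← Algebra.smul_def, smul_smul,
    inv_mul_cancel₀ hc, one_smul] at h1

/-! ### The spectral data morphism on coordinate rings -/

variable (k n d) in
/-- The homomorphism `k[𝔱^d]^W → k[ℭ]` defining the spectral data morphism. -/
noncomputable def spectralHom : weylInvariants k n d →ₐ[k] CoordRing k n d :=
  (univPoint k n d).comp (chowEquiv k n d).symm.toAlgHom

theorem spectralHom_comp_chowEquiv :
    (spectralHom k n d).comp (chowEquiv k n d).toAlgHom = univPoint k n d := by
  ext x
  simp [spectralHom]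

theorem restrict_comp_spectralHom :
    (restrict k n d).comp (spectralHom k n d) = (weylInvariants k n d).val := by
  ext x : 1
  obtain ⟨y, rfl⟩ := (chowEquiv k n d).surjective x
  have h1 := DFunLike.congr_fun (spectralHom_comp_chowEquiv (k := k) (n := n) (d := d)) y
  have h2 := DFunLike.congr_fun (restrict_comp_univPoint (k := k) (n := n) (d := d)) y
  exact (congrArg (restrict k n d) h1).trans h2

theorem coaction_comp_spectralHom :
    (coaction k n d).comp (spectralHom k n d) =
      (Algebra.TensorProduct.includeRight : CoordRing k n d →ₐ[k] GLTensor k n d).comp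
        (spectralHom k n d) := by
  rw [spectralHom, ← AlgHom.comp_assoc, coaction_comp_univPoint, AlgHom.comp_assoc]

/-- Writing an invariant as `univPoint` of x, its restriction to 𝔱^d is x under the Chow
identification, and `spectralHom` carries it back. -/
theorem spectralHom_comp_restrictInvariants :
    (spectralHom k n d).comp (restrictInvariants k n d) = (invariants k n d).val := by
  ext f : 1
  obtain ⟨x, hx⟩ := mem_range_univPoint f.2
  have h1 : restrictInvariants k n d f = chowEquiv k n d x := by
    apply Subtype.ext
    change restrict k n d f = tensorEquiv k n d x
    rw [← hx]
    exact DFunLike.congr_fun restrict_comp_univPoint x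
  rw [AlgHom.comp_apply, h1]
  exact (DFunLike.congr_fun spectralHom_comp_chowEquiv x).trans hx

theorem isReduced_invariants : _root_.IsReduced (invariants k n d) := by
  have h : Function.Injective (restrictInvariants k n d) := by
    refine Function.Injective.of_comp (f := spectralHom k n d) ?_
    rw [← AlgHom.coe_comp, spectralHom_comp_restrictInvariants]
    exact Subtype.val_injective
  exact isReduced_of_injective (restrictInvariants k n d) h

end

end CommutingScheme

open CommutingScheme in
theorem mainTheorem1 {k : Type u} [Field k] [IsAlgClosed k] [CharZero k] (n d : ℕ) :
    (∃ sd : CommutingScheme.scheme k n d ⟶ cartanQuotient k n d,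
      IsGLInvariant sd ∧
      cartanEmbedding k n d ≫ sd = cartanQuotientMap k n d ∧
      sd ≫ chevalley k n d = CommutingScheme.quotientMap k n d ∧
      ∀ (R : Type u) [CommRing R] [Algebra k R] (α : Fin d → Matrix (Fin n) (Fin n) R)
        (hα : ∀ i j, α i * α j = α j * α i),
        ∃ z : chowRing k n d →ₐ[k] R,
          specMap (point α hα) ≫ sd ≫ (chowIso k n d).hom = specMap z ∧
          (∀ f : MvPolynomial (Fin d) k, z (tensorPow n f) = (symHom k α hα f).det) ∧
          ∀ z' : chowRing k n d →ₗ[k] R,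
            (∀ f : MvPolynomial (Fin d) k, z' (tensorPow n f) = (symHom k α hα f).det) →
              z' = z.toLinearMap) ∧
    AlgebraicGeometry.IsReduced (CommutingScheme.quotient k n d).left := by
  refine ⟨⟨specMap (spectralHom k n d), ?_, ?_, ?_, fun R _ _ α hα =>
    ⟨chowPoint α hα, ?_, chowPoint_tensorPow α hα, chowPoint_unique α hα⟩⟩, ?_⟩
  · rw [IsGLInvariant, actionMap, secondProj, ← specMap_comp, ← specMap_comp,
      coaction_comp_spectralHom]
  · rw [cartanEmbedding, ← specMap_comp, restrict_comp_spectralHom, cartanQuotientMap]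
  · rw [chevalley, ← specMap_comp, spectralHom_comp_restrictInvariants,
      CommutingScheme.quotientMap]
  · rw [chowIso, ← specMap_comp, ← specMap_comp, spectralHom_comp_chowEquiv, point_comp_univPoint]
  · have := isReduced_invariants (k := k) (n := n) (d := d)
    change AlgebraicGeometry.IsReduced (Spec (CommRingCat.of (invariants k n d)))
    infer_instance
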